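/- Let $d\in\mathbb N$ and let $\varphi:\mathbb R^d\to\mathbb R$ be $K$-Lipschitz and $\lambda$-concave for some $K,\lambda\ge 0$ (that is, $y\mapsto\varphi(y)-\tfrac{\lambda}{2}|y|^2$ is concave). Fix $t>0$. Let $f^*(x)=\sup_y\,(x\cdot y-f(y))$ denote the Legendre transform, and put $\psi_t(y)=\tfrac12|y|^2+t\varphi(y)$, $w_t=\psi_t^*$, $T_t=\nabla\psi_t^{**}$. Let $\mu_t$ be the Monge--Ampère measure of $w_t$, $\mu_t(B)=|\partial w_t(B)|$ for Borel $B$, where $\partial w_t$ is the subgradient and $|\cdot|$ is Lebesgue measure. Define $\breve\varphi$ by $\psi_t^{**}(y)=\tfrac12|y|^2+t\breve\varphi(y)$, and let $$\breve u_s(x)=\inf_y\Big(\frac{|x-y|^2}{2s}+\breve\varphi(y)\Big),\qquad s>0 .$$ Let $\partial\breve u_s(x)$ be the set of all $q\in\mathbb R^d$ with $\breve u_s(z)\le \breve u_s(x)+q\cdot(z-x)+\tfrac12\lambda_s|z-x|^2$ for all $z$, where $\lambda_s=\lambda/(1+\lambda s)$. The modified Lagrangian flow $(\breve X_s)_{0\le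 s\le t}$ consists, for each $y$, of the Lipschitz path $s\mapsto\breve X_s(y)$ on $[0,t]$ that satisfies $$\partial_s\breve X_s(y)\in\partial\breve u_s(\breve X_s(y))\ \text{ for a.e. } s\in(0,t),\qquad \breve X_0(y)=y .$$ Then $\psi_t^{**}$ and $\breve\varphi$ are differentiable, the modified Lagrangian flow exists and is unique, and: (i) for $0\le s<t$ the map $\breve X_s:\mathbb R^d\to\mathbb R^d$ is bijective, with $\breve X_s(y)=y+s\nabla\breve\varphi(y)$ for all $y$; (ii) $\breve X_t(y)=T_t(y)$ for all $y\in\mathbb R^d$, and the pushforward $\breve\rho_t=(\breve X_t)_\sharp\mathcal L^d$ of Lebesgue measure satisfies $\breve\rho_t=\mu_t$. -/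

import Mathlib

open MeasureTheory Set

noncomputable section

/-- `f` is `lam`-concave: `y ↦ f y - (lam / 2) |y|²` is concave on the whole space. -/
def LamConcave {d : ℕ} (lam : ℝ) (f : EuclideanSpace ℝ (Fin d) → ℝ) : Prop :=
  ConcaveOn ℝ univ (fun y => f y - lam / 2 * ‖y‖ ^ 2)

/-- The Legendre transform `f^*(x) = sup_y (x · y - f y)`. In the theorem it is applied to
`½|y|² + t φ(y)` with `φ` Lipschitz, and to the transform of that function; the suprema are then
finite. -/
def legendre {d : ℕ} (f : EuclideanSpace ℝ (Fin d) → ℝ) (x : EuclideanSpace ℝ (Fin d)) : ℝ :=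
  ⨆ y : EuclideanSpace ℝ (Fin d), (inner ℝ x y - f y)

/-- The free streaming potential `ψ_t(y) = ½|y|² + t φ(y)`. -/
def streamPotential {d : ℕ} (φ : EuclideanSpace ℝ (Fin d) → ℝ) (t : ℝ)
    (y : EuclideanSpace ℝ (Fin d)) : ℝ :=
  1 / 2 * ‖y‖ ^ 2 + t * φ y

/-- The potential `w_t = ψ_t^*`. -/
def dualPotential {d : ℕ} (φ : EuclideanSpace ℝ (Fin d) → ℝ) (t : ℝ) :
    EuclideanSpace ℝ (Fin d) → ℝ :=
  legendre (streamPotential φ t)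

/-- The convexified potential `ψ_t^{**}`. -/
def convexifiedPotential {d : ℕ} (φ : EuclideanSpace ℝ (Fin d) → ℝ) (t : ℝ) :
    EuclideanSpace ℝ (Fin d) → ℝ :=
  legendre (legendre (streamPotential φ t))

/-- The convexified transport map `T_t = ∇ψ_t^{**}`. -/
def transportMap {d : ℕ} (φ : EuclideanSpace ℝ (Fin d) → ℝ) (t : ℝ)
    (y : EuclideanSpace ℝ (Fin d)) : EuclideanSpace ℝ (Fin d) :=
  gradient (convexifiedPotential φ t) y

/-- The modified initial potential, i.e. the solution (for `t ≠ 0`) of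
`ψ_t^{**}(y) = ½|y|² + t φ̆(y)`. -/
def modifiedPotential {d : ℕ} (φ : EuclideanSpace ℝ (Fin d) → ℝ) (t : ℝ)
    (y : EuclideanSpace ℝ (Fin d)) : ℝ :=
  (convexifiedPotential φ t y - 1 / 2 * ‖y‖ ^ 2) / t

/-- The Hopf-Lax formula `u_s(x) = inf_y (|x - y|² / (2 s) + φ(y))`, used for `s > 0` and
Lipschitz `φ`, where the infimum is finite. -/
def hopfLax {d : ℕ} (φ : EuclideanSpace ℝ (Fin d) → ℝ) (s : ℝ)
    (x : EuclideanSpace ℝ (Fin d)) : ℝ :=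
  ⨅ y : EuclideanSpace ℝ (Fin d), (‖x - y‖ ^ 2 / (2 * s) + φ y)

/-- The differential of a `lam`-concave function: the slopes at `x` of the paraboloids with
Hessian `lam • I` that lie above the graph and touch it at `x`. For a given semi-concave `f` the
set does not depend on the choice of `lam` for which `f` is `lam`-concave. -/
def differential {d : ℕ} (lam : ℝ) (f : EuclideanSpace ℝ (Fin d) → ℝ)
    (x : EuclideanSpace ℝ (Fin d)) : Set (EuclideanSpace ℝ (Fin d)) :=
  {q | ∀ z, f z ≤ f x + inner ℝ q (z - x) + lam / 2 * ‖z - x‖ ^ 2}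

/-- `X` is the Lagrangian flow on the time interval `[0, t]` for the `lam`-concave initial
potential `φ`: for every `y`, the path `s ↦ X s y` is a Lipschitz solution of
`∂_s X_s(y) ∈ ∂u_s(X_s(y))` for a.e. `s ∈ (0, t)`, `X_0(y) = y`, where `u` is given by the
Hopf-Lax formula. (`u_s` is `lam / (1 + lam s)`-concave.) -/
structure IsLagrangianFlow {d : ℕ} (lam : ℝ) (φ : EuclideanSpace ℝ (Fin d) → ℝ) (t : ℝ)
    (X : ℝ → EuclideanSpace ℝ (Fin d) → EuclideanSpace ℝ (Fin d)) : Prop where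
  lipschitz : ∀ y, ∃ L : NNReal, LipschitzOnWith L (fun s => X s y) (Icc 0 t)
  initial : ∀ y, X 0 y = y
  inclusion : ∀ y, ∀ᵐ s ∂(volume.restrict (Ioo 0 t)),
    ∃ q ∈ differential (lam / (1 + lam * s)) (hopfLax φ s) (X s y),
      HasDerivAt (fun r => X r y) q s

/-- The subgradient `∂w(x)` of a convex function. -/
def subgradient {d : ℕ} (w : EuclideanSpace ℝ (Fin d) → ℝ) (x : EuclideanSpace ℝ (Fin d)) :
    Set (EuclideanSpace ℝ (Fin d)) :=
  {y | ∀ z, w x + inner ℝ y (z - x) ≤ w z}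

/-- The image `∂w(B) = ⋃_{x ∈ B} ∂w(x)`. -/
def subgradientImage {d : ℕ} (w : EuclideanSpace ℝ (Fin d) → ℝ)
    (B : Set (EuclideanSpace ℝ (Fin d))) : Set (EuclideanSpace ℝ (Fin d)) :=
  ⋃ x ∈ B, subgradient w x

/-- The Monge-Ampère measure of a convex function `w`, as a function of the Borel set `B`:
the Lebesgue measure of `∂w(B)`. -/
def mongeAmpere {d : ℕ} (w : EuclideanSpace ℝ (Fin d) → ℝ)
    (B : Set (EuclideanSpace ℝ (Fin d))) : ENNReal :=
  volume (subgradientImage w B)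

end

open Filter Topology

/-! ### Duality between semi-concavity and strong convexity. -/

section Convexity

variable {d : ℕ}

/-! Duality turns the semi-concavity of `ψ_t` into strong convexity of `w_t`, with modulus
`1/(1+tλ)` (`LamConcave.hasStrongSupport_legendre`). A second transform makes `ψ_t^{**}` convex and
differentiable, lying below its tangent paraboloids of Hessian `1+tλ`
(`HasStrongSupport.legendre_bounds`). Subtracting `½|y|²` and dividing by `t` bounds `φ̆` around
each point by paraboloids of Hessian `-1/t` and `λ`. The lower bound keeps the lines `y + s∇φ̆(y)`
from crossing before time `t` and makes `y` a Hopf-Lax minimiser along its line; the upper bound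
puts `∇φ̆(y)` in the differential of the Hopf-Lax function (`mem_differential_hopfLax`). So the
lines solve the inclusion, and one-sided Lipschitz continuity with Gronwall excludes other solutions
(`IsLagrangianFlow.eqOn`). At time `t` the line reaches `T_t(y)`. Since `y ∈ ∂w_t(x)` iff `T_t(y) =
x`, `∂w_t(B)` is `T_t⁻¹(B)`, which identifies the two measures. -/

theorem le_of_forall_sub_mul_le {a b c : ℝ} (h : ∀ θ : ℝ, 0 < θ → θ < 1 → a - b * θ ≤ c) :
    a ≤ c := by
  have ht : Tendsto (fun θ : ℝ => a - b * θ) (𝓝[>] 0) (𝓝 a) := by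
    have : Tendsto (fun θ : ℝ => a - b * θ) (𝓝 0) (𝓝 (a - b * 0)) :=
      Continuous.tendsto (by fun_prop) 0
    simpa using this.mono_left nhdsWithin_le_nhds
  refine le_of_tendsto ht ?_
  filter_upwards [Ioo_mem_nhdsGT (zero_lt_one' ℝ)] with θ hθ using h θ hθ.1 hθ.2

theorem eq_zero_of_inner_add_sq_nonneg {r : EuclideanSpace ℝ (Fin d)} {C : ℝ}
    (h : ∀ k : EuclideanSpace ℝ (Fin d), 0 ≤ inner ℝ r k + C * ‖k‖ ^ 2) : r = 0 := by
  have h1 : ‖r‖ ^ 2 ≤ 0 := by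
    refine le_of_forall_sub_mul_le (b := C * ‖r‖ ^ 2) fun θ h0 _ => ?_
    have := h (-(θ • r))
    rw [inner_neg_right, real_inner_smul_right, real_inner_self_eq_norm_sq, norm_neg, norm_smul,
      Real.norm_of_nonneg h0.le] at this
    have : 0 ≤ θ * (-(‖r‖ ^ 2 - C * ‖r‖ ^ 2 * θ)) := by linarith
    linarith [nonneg_of_mul_nonneg_right this h0]
  simpa using le_antisymm h1 (by positivity)

theorem hasGradientAt_of_quadratic_bounds {f : EuclideanSpace ℝ (Fin d) → ℝ}
    {x p : EuclideanSpace ℝ (Fin d)} {C : ℝ}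
    (hlow : ∀ h, f x + inner ℝ p h - C * ‖h‖ ^ 2 ≤ f (x + h))
    (hupp : ∀ h, f (x + h) ≤ f x + inner ℝ p h + C * ‖h‖ ^ 2) : HasGradientAt f p x := by
  rw [hasGradientAt_iff_isLittleO_nhds_zero]
  have h1 : (fun h => f (x + h) - f x - inner ℝ p h) =O[𝓝 0]
    fun h : EuclideanSpace ℝ (Fin d) => ‖h‖ ^ 2 := by
    refine Asymptotics.IsBigO.of_bound C (Eventually.of_forall fun h => ?_)
    rw [Real.norm_eq_abs, Real.norm_of_nonneg (by positivity), abs_le]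
    constructor <;> linarith [hlow h, hupp h]
  refine h1.trans_isLittleO ?_
  simpa using (Asymptotics.isLittleO_norm_pow_id (E' := EuclideanSpace ℝ (Fin d)) one_lt_two)

/-- A continuous function with quadratic growth attains its minimum. -/
theorem exists_forall_le_of_quadratic_growth {f : EuclideanSpace ℝ (Fin d) → ℝ}
    (hf : Continuous f) {a b c : ℝ}
    (hc : 0 < c) (h : ∀ z, a - b * ‖z‖ + c * ‖z‖ ^ 2 ≤ f z) : ∃ y, ∀ z, f y ≤ f z := by
  refine hf.exists_forall_le (tendsto_atTop_mono h ?_)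
  have h1 : Tendsto (fun r : ℝ => a + r * (c * r - b)) atTop atTop := by
    refine tendsto_atTop_add_const_left _ _ (Tendsto.atTop_mul_atTop₀ tendsto_id ?_)
    exact tendsto_atTop_add_const_right _ _ (tendsto_id.const_mul_atTop hc)
  refine (h1.comp (@tendsto_norm_cocompact_atTop (EuclideanSpace ℝ (Fin d)) _ _)).congr fun z => ?_
  simp only [Function.comp]
  ring

/-- If an affine function touches a `lam`-concave function from below, then its slope lies in
the differential. -/
theorem LamConcave.mem_differential {lam : ℝ} {g : EuclideanSpace ℝ (Fin d) → ℝ}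
    (hg : LamConcave lam g) {x y : EuclideanSpace ℝ (Fin d)}
    (h : ∀ z, g y + inner ℝ x (z - y) ≤ g z) : x ∈ differential lam g y := by
  intro z
  obtain ⟨k, rfl⟩ : ∃ k, z = y + k := ⟨z - y, by abel⟩
  rw [add_sub_cancel_left]
  have key : g (y + k) - g y - inner ℝ x k - lam / 2 * ‖k‖ ^ 2 ≤ 0 := by
    refine le_of_forall_sub_mul_le (b := lam / 2 * ‖k‖ ^ 2) fun θ h0 _ => ?_
    have h1 : (0 : ℝ) < 1 + θ := by linarith
    -- With these weights `y` is the convex combination of `y + k` and `y - θ • k`. The affine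
    -- support bounds `g` below at the second point, hence above at the first.
    have hc := hg.2 (mem_univ (y + k)) (mem_univ (y - θ • k))
      (show 0 ≤ θ / (1 + θ) by positivity) (show 0 ≤ 1 / (1 + θ) by positivity)
      (by field_simp; ring)
    have hy : (θ / (1 + θ)) • (y + k) + (1 / (1 + θ)) • (y - θ • k) = y := by
      have hb : θ / (1 + θ) = 1 - 1 / (1 + θ) := by field_simp; ring
      have ha : 1 / (1 + θ) * θ = 1 - 1 / (1 + θ) := by field_simp; ring
      rw [smul_sub, smul_smul, ha, hb]
      module
    rw [hy] at hc
    have hl := h (y - θ • k)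
    simp only [smul_eq_mul] at hc
    rw [norm_add_sq_real, norm_sub_sq_real, real_inner_smul_right, norm_smul,
      Real.norm_of_nonneg h0.le] at hc
    rw [show y - θ • k - y = -(θ • k) by abel, inner_neg_right, real_inner_smul_right] at hl
    have hc' : (θ / (1 + θ) * (g (y + k) - lam / 2 * (‖y‖ ^ 2 + 2 * inner ℝ y k + ‖k‖ ^ 2)) +
        1 / (1 + θ) * (g (y - θ • k) -
          lam / 2 * (‖y‖ ^ 2 - 2 * (θ * inner ℝ y k) + (θ * ‖k‖) ^ 2))) * (1 + θ) ≤
        (g y - lam / 2 * ‖y‖ ^ 2) * (1 + θ) := by gcongr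
    field_simp at hc'
    have : 0 ≤ θ * -(g (y + k) - g y - inner ℝ x k - lam / 2 * ‖k‖ ^ 2
        - lam / 2 * ‖k‖ ^ 2 * θ) := by
      linarith
    linarith [nonneg_of_mul_nonneg_right this h0]
  linarith

/-- `w` has at every point an affine support from which it detaches quadratically. -/
def HasStrongSupport (m : ℝ) (w : EuclideanSpace ℝ (Fin d) → ℝ) : Prop :=
  ∀ x, ∃ y, ∀ x', w x + inner ℝ y (x' - x) + m / 2 * ‖x' - x‖ ^ 2 ≤ w x'

/-- Averaging the support at the intermediate point over the two endpoints cancels the linear terms.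
-/
theorem HasStrongSupport.le_combination {m : ℝ} {w : EuclideanSpace ℝ (Fin d) → ℝ}
    (hw : HasStrongSupport m w)
    (x h : EuclideanSpace ℝ (Fin d)) {θ : ℝ} (h0 : 0 ≤ θ) (h1 : θ ≤ 1) :
    w (x + θ • h) + m / 2 * (θ * (1 - θ)) * ‖h‖ ^ 2 ≤ (1 - θ) * w x + θ * w (x + h) := by
  obtain ⟨y, hy⟩ := hw (x + θ • h)
  have hA := hy x
  have hB := hy (x + h)
  rw [show x - (x + θ • h) = -(θ • h) by abel, inner_neg_right, real_inner_smul_right, norm_neg,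
    norm_smul, Real.norm_of_nonneg h0] at hA
  rw [show x + h - (x + θ • h) = (1 - θ) • h by module, real_inner_smul_right,
    norm_smul, Real.norm_of_nonneg (sub_nonneg.2 h1)] at hB
  have hA' := mul_le_mul_of_nonneg_left hA (sub_nonneg.2 h1)
  have hB' := mul_le_mul_of_nonneg_left hB h0
  linarith

theorem HasStrongSupport.continuous {m : ℝ} (hm : 0 ≤ m) {w : EuclideanSpace ℝ (Fin d) → ℝ}
    (hw : HasStrongSupport m w) : Continuous w := by
  have hconv : ConvexOn ℝ univ w := by
    refine ⟨convex_univ, fun x _ z _ a b ha hb hab => ?_⟩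
    have := hw.le_combination x (z - x) hb (by linarith)
    rw [show x + b • (z - x) = a • x + b • z by rw [← eq_sub_iff_add_eq] at hab; rw [hab]; module,
      add_sub_cancel, show 1 - b = a by linarith] at this
    simp only [smul_eq_mul]
    have h2 : 0 ≤ m / 2 * (b * a) * ‖z - x‖ ^ 2 := by positivity
    linarith
  exact continuousOn_univ.1 (hconv.continuousOn isOpen_univ)

/-- Strong support provides one good slope per point; this extends it to every subgradient, by
comparing along the segment, dividing by `θ` and letting `θ → 0`. -/
theorem HasStrongSupport.detach {m : ℝ} {w : EuclideanSpace ℝ (Fin d) → ℝ}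
    (hw : HasStrongSupport m w) {x y : EuclideanSpace ℝ (Fin d)}
    (hy : y ∈ subgradient w x) (x' : EuclideanSpace ℝ (Fin d)) :
    w x + inner ℝ y (x' - x) + m / 2 * ‖x' - x‖ ^ 2 ≤ w x' := by
  obtain ⟨h, rfl⟩ : ∃ h, x' = x + h := ⟨x' - x, by abel⟩
  rw [add_sub_cancel_left]
  have key : m / 2 * ‖h‖ ^ 2 ≤ w (x + h) - w x - inner ℝ y h := by
    refine le_of_forall_sub_mul_le (b := m / 2 * ‖h‖ ^ 2) fun θ h0 h1 => ?_
    have hc := hw.le_combination x h h0.le h1.le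
    have hs := hy (x + θ • h)
    rw [add_sub_cancel_left, real_inner_smul_right] at hs
    have : 0 ≤ θ * (w (x + h) - w x - inner ℝ y h - (m / 2 * ‖h‖ ^ 2 - m / 2 * ‖h‖ ^ 2 * θ)) := by
      linarith
    linarith [nonneg_of_mul_nonneg_right this h0]
  linarith

theorem HasStrongSupport.exists_mem_subgradient {m : ℝ} (hm : 0 < m)
    {w : EuclideanSpace ℝ (Fin d) → ℝ}
    (hw : HasStrongSupport m w) (y : EuclideanSpace ℝ (Fin d)) : ∃ x, y ∈ subgradient w x := by
  obtain ⟨y₀, hy₀⟩ := hw 0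
  obtain ⟨x, hx⟩ := exists_forall_le_of_quadratic_growth (f := fun x => w x - inner ℝ y x)
    ((hw.continuous hm.le).sub (by fun_prop)) (a := w 0) (b := ‖y₀ - y‖) (c := m / 2)
    (by positivity) (fun z => by
      have h1 := hy₀ z
      have h2 := neg_le_of_abs_le (abs_real_inner_le_norm (y₀ - y) z)
      rw [inner_sub_left] at h2
      rw [sub_zero] at h1
      linarith)
  refine ⟨x, fun z => ?_⟩
  have := hx z
  rw [inner_sub_right]
  linarith

theorem legendre_eq_of_mem_subgradient {w : EuclideanSpace ℝ (Fin d) → ℝ}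
    {x y : EuclideanSpace ℝ (Fin d)} (hy : y ∈ subgradient w x) :
    legendre w y = inner ℝ y x - w x := by
  have h : ∀ z, inner ℝ y z - w z ≤ inner ℝ y x - w x := fun z => by
    have := hy z
    rw [inner_sub_right] at this
    linarith
  exact le_antisymm (ciSup_le h)
    (le_ciSup (f := fun z => inner ℝ y z - w z) ⟨_, forall_mem_range.2 h⟩ x)

theorem le_legendre {w : EuclideanSpace ℝ (Fin d) → ℝ} {y : EuclideanSpace ℝ (Fin d)}
    (h : ∃ x, y ∈ subgradient w x) (z : EuclideanSpace ℝ (Fin d)) :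
    inner ℝ y z - w z ≤ legendre w y := by
  obtain ⟨x, hx⟩ := h
  rw [legendre_eq_of_mem_subgradient hx]
  have := hx z
  rw [inner_sub_right] at this
  linarith

/-- The Legendre transform of a coercive `lam`-concave function is strongly convex. -/
theorem LamConcave.hasStrongSupport_legendre {lam : ℝ} (hlam : 0 < lam)
    {g : EuclideanSpace ℝ (Fin d) → ℝ}
    (hg : LamConcave lam g) (hex : ∀ x, ∃ y, x ∈ subgradient g y) :
    HasStrongSupport (1 / lam) (legendre g) := by
  intro x
  obtain ⟨y, hy⟩ := hex x
  refine ⟨y, fun x' => ?_⟩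
  obtain ⟨h, rfl⟩ : ∃ h, x' = x + h := ⟨x' - x, by abel⟩
  -- The step `h / lam` maximises `h · k - (lam / 2) |k|²` over `k`.
  have h1 := hg.mem_differential hy (y + (1 / lam) • h)
  have h2 := le_legendre (hex (x + h)) (y + (1 / lam) • h)
  rw [legendre_eq_of_mem_subgradient hy]
  rw [add_sub_cancel_left] at h1 ⊢
  rw [norm_smul, Real.norm_of_nonneg (by positivity), real_inner_smul_right] at h1
  rw [inner_add_left, inner_add_right, inner_add_right, real_inner_smul_right,
    real_inner_smul_right, real_inner_self_eq_norm_sq] at h2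
  rw [real_inner_comm h y]
  have h3 : lam / 2 * (1 / lam * ‖h‖) ^ 2 = 1 / lam / 2 * ‖h‖ ^ 2 := by field_simp
  have h4 : 1 / lam * ‖h‖ ^ 2 = 2 * (1 / lam / 2 * ‖h‖ ^ 2) := by ring
  linarith

/-- Two-sided quadratic bounds for the Legendre transform of a strongly convex function. -/
theorem HasStrongSupport.legendre_bounds {m : ℝ} (hm : 0 < m) {w : EuclideanSpace ℝ (Fin d) → ℝ}
    (hw : HasStrongSupport m w) {x y : EuclideanSpace ℝ (Fin d)} (hy : y ∈ subgradient w x)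
      (k : EuclideanSpace ℝ (Fin d)) :
    legendre w y + inner ℝ x k ≤ legendre w (y + k) ∧
    legendre w (y + k) ≤ legendre w y + inner ℝ x k + 1 / m / 2 * ‖k‖ ^ 2 := by
  rw [legendre_eq_of_mem_subgradient hy]
  constructor
  · have := le_legendre (hw.exists_mem_subgradient hm (y + k)) x
    rw [inner_add_left, real_inner_comm x k] at this
    linarith
  · refine ciSup_le fun z => ?_
    have h1 := hw.detach hy z
    -- Completing the square bounds `k · (z - x) - (m / 2) |z - x|²` uniformly in `z`.
    have h2 : 0 ≤ m / 2 * ‖(z - x) - (1 / m) • k‖ ^ 2 := by positivity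
    rw [norm_sub_sq_real, norm_smul, Real.norm_of_nonneg (by positivity),
      real_inner_smul_right] at h2
    have h3 : m / 2 * (‖z - x‖ ^ 2 - 2 * (1 / m * inner ℝ (z - x) k) + (1 / m * ‖k‖) ^ 2) =
      m / 2 * ‖z - x‖ ^ 2 - inner ℝ (z - x) k + 1 / m / 2 * ‖k‖ ^ 2 := by field_simp
    rw [h3, inner_sub_left] at h2
    rw [inner_sub_right] at h1
    rw [inner_add_left, real_inner_comm z k]
    linarith

theorem HasStrongSupport.hasGradientAt_legendre {m : ℝ} (hm : 0 < m)
    {w : EuclideanSpace ℝ (Fin d) → ℝ}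
    (hw : HasStrongSupport m w) {x y : EuclideanSpace ℝ (Fin d)} (hy : y ∈ subgradient w x) :
    HasGradientAt (legendre w) x y :=
  hasGradientAt_of_quadratic_bounds (C := 1 / m / 2)
    (fun k => by
      have : 0 ≤ 1 / m / 2 * ‖k‖ ^ 2 := by positivity
      linarith [(hw.legendre_bounds hm hy k).1])
    fun k => (hw.legendre_bounds hm hy k).2

/-- Every `y` is a subgradient somewhere, and uniqueness of the gradient of the transform determines
where. -/
theorem HasStrongSupport.mem_subgradient_iff {m : ℝ} (hm : 0 < m) {w : EuclideanSpace ℝ (Fin d) → ℝ}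
    (hw : HasStrongSupport m w) {x y : EuclideanSpace ℝ (Fin d)} :
    y ∈ subgradient w x ↔ gradient (legendre w) y = x := by
  refine ⟨fun h => (hw.hasGradientAt_legendre hm h).gradient, ?_⟩
  rintro rfl
  obtain ⟨x, hx⟩ := hw.exists_mem_subgradient hm y
  rwa [(hw.hasGradientAt_legendre hm hx).gradient]

theorem HasStrongSupport.subgradientImage_eq {m : ℝ} (hm : 0 < m) {w : EuclideanSpace ℝ (Fin d) → ℝ}
    (hw : HasStrongSupport m w) (B : Set (EuclideanSpace ℝ (Fin d))) :
    subgradientImage w B = gradient (legendre w) ⁻¹' B := by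
  ext y
  simp [subgradientImage, hw.mem_subgradient_iff hm]

end Convexity

/-! ### Uniqueness of Lagrangian flows, and straight lines as solutions. -/

section Flow

variable {d : ℕ}

/-- An absolutely continuous Gronwall inequality. -/
theorem AbsolutelyContinuousOnInterval.nonpos_of_deriv_le {D : ℝ → ℝ} {C T : ℝ} (hT : 0 ≤ T)
    (hD : AbsolutelyContinuousOnInterval D 0 T) (h0 : D 0 = 0)
    (hd : ∀ᵐ s ∂(volume.restrict (Ioo 0 T)), ∃ D', HasDerivAt D D' s ∧ D' ≤ C * D s) :
    D T ≤ 0 := by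
  have hexp : AbsolutelyContinuousOnInterval (fun s => Real.exp (-C * s)) 0 T :=
    ContDiffOn.absolutelyContinuousOnInterval (by fun_prop)
  have hac := hexp.mul hD
  have hint := hac.integral_deriv_eq_sub
  have hneg : ∫ s in (0 : ℝ)..T, deriv ((fun s => Real.exp (-C * s)) * D) s ≤ 0 := by
    rw [intervalIntegral.integral_of_le hT, integral_Ioc_eq_integral_Ioo]
    refine integral_nonpos_of_ae ?_
    filter_upwards [hd] with s hs
    obtain ⟨D', hD', hle⟩ := hs
    have he : HasDerivAt (fun s => Real.exp (-C * s)) (Real.exp (-C * s) * (-C)) s := by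
      simpa using ((hasDerivAt_id s).const_mul (-C)).exp
    rw [(he.mul hD').deriv]
    have := mul_le_mul_of_nonneg_left hle (Real.exp_pos (-C * s)).le
    simp only [Pi.zero_apply]
    linarith
  rw [hint] at hneg
  simp only [Pi.mul_apply, h0, mul_zero, sub_zero] at hneg
  exact nonpos_of_mul_nonpos_right hneg (Real.exp_pos _)

/-- The differential is one-sided Lipschitz. -/
theorem inner_sub_le_of_mem_differential {lam : ℝ} {u : EuclideanSpace ℝ (Fin d) → ℝ}
    {x x' q q' : EuclideanSpace ℝ (Fin d)}
    (hq : q ∈ differential lam u x) (hq' : q' ∈ differential lam u x') :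
    inner ℝ (q - q') (x - x') ≤ lam * ‖x - x'‖ ^ 2 := by
  have h1 := hq x'
  have h2 := hq' x
  rw [← neg_sub x x', inner_neg_right, norm_neg] at h1
  rw [inner_sub_left]
  linarith

/-- Lagrangian flows for a given potential are unique. -/
theorem IsLagrangianFlow.eqOn {lam : ℝ} (hlam : 0 ≤ lam) {f : EuclideanSpace ℝ (Fin d) → ℝ} {t : ℝ}
    {X Z : ℝ → EuclideanSpace ℝ (Fin d) → EuclideanSpace ℝ (Fin d)}
      (hX : IsLagrangianFlow lam f t X) (hZ : IsLagrangianFlow lam f t Z)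
    {s : ℝ} (hs : s ∈ Icc 0 t) (y : EuclideanSpace ℝ (Fin d)) : X s y = Z s y := by
  obtain ⟨L, hL⟩ := hX.lipschitz y
  obtain ⟨M, hM⟩ := hZ.lipschitz y
  have hsub : uIcc 0 s ⊆ Icc 0 t := by
    rw [uIcc_of_le hs.1]
    exact Icc_subset_Icc le_rfl hs.2
  have hN : LipschitzOnWith (1 * (L + M)) (fun r => ‖X r y - Z r y‖) (uIcc 0 s) :=
    lipschitzWith_one_norm.comp_lipschitzOnWith ((hL.sub hM).mono hsub)
  have hac := hN.absolutelyContinuousOnInterval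
  have hle : ((fun r => ‖X r y - Z r y‖) * fun r => ‖X r y - Z r y‖) s ≤ 0 := by
    refine (hac.mul hac).nonpos_of_deriv_le (C := 2 * lam) hs.1
      (by simp [hX.initial, hZ.initial]) ?_
    have hss : Ioo 0 s ⊆ Ioo 0 t := Ioo_subset_Ioo le_rfl hs.2
    filter_upwards [ae_restrict_of_ae_restrict_of_subset hss (hX.inclusion y),
      ae_restrict_of_ae_restrict_of_subset hss (hZ.inclusion y),
      ae_restrict_mem measurableSet_Ioo] with r h1 h2 hr
    obtain ⟨q, hq, hqd⟩ := h1
    obtain ⟨q', hq', hqd'⟩ := h2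
    refine ⟨2 * inner ℝ (X r y - Z r y) (q - q'), ?_, ?_⟩
    · have := (hqd.sub hqd').norm_sq
      refine this.congr_of_eventuallyEq (Eventually.of_forall fun r => ?_)
      simp [pow_two]
    · have h3 := inner_sub_le_of_mem_differential hq hq'
      -- Gronwall is used with a rate that does not depend on time.
      have h4 : lam / (1 + lam * r) ≤ lam :=
        div_le_self hlam (by have := mul_nonneg hlam hr.1.le; linarith)
      have h5 : lam / (1 + lam * r) * ‖X r y - Z r y‖ ^ 2 ≤ lam * ‖X r y - Z r y‖ ^ 2 := by
        gcongr
      rw [real_inner_comm]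
      simp only [Pi.mul_apply]
      linarith
  simp only [Pi.mul_apply] at hle
  have : ‖X s y - Z s y‖ = 0 := by nlinarith [norm_nonneg (X s y - Z s y)]
  exact sub_eq_zero.1 (norm_eq_zero.1 this)

variable {lam t : ℝ} {f : EuclideanSpace ℝ (Fin d) → ℝ}
    {p : EuclideanSpace ℝ (Fin d) → EuclideanSpace ℝ (Fin d)}

/-- Adding the lower bounds at `y` and `z` gives `(p z - p y) · (z - y) ≥ -|z - y|² / t`, whereas a
collision at time `s > 0` forces the value `-|z - y|² / s`. -/
theorem id_add_smul_injective (ht : 0 < t)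
    (hlow : ∀ y k, f y + inner ℝ (p y) k - ‖k‖ ^ 2 / (2 * t) ≤ f (y + k))
    {s : ℝ} (hs : 0 ≤ s) (hst : s < t) : Function.Injective fun y => y + s • p y := by
  intro y z hyz
  simp only at hyz
  have h1 := hlow y (z - y)
  have h2 := hlow z (y - z)
  rw [add_sub_cancel] at h1 h2
  rw [← neg_sub z y, inner_neg_right, norm_neg] at h2
  have h3 : inner ℝ (p z) (z - y) ≥ inner ℝ (p y) (z - y) - ‖z - y‖ ^ 2 / t := by
    have : ‖z - y‖ ^ 2 / t = 2 * (‖z - y‖ ^ 2 / (2 * t)) := by field_simp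
    linarith
  have h4 : z - y = s • (p y - p z) := by
    rw [smul_sub, sub_eq_sub_iff_add_eq_add, ← hyz, add_comm]
  have h5 : ‖z - y‖ ^ 2 = s * (inner ℝ (p y) (z - y) - inner ℝ (p z) (z - y)) := by
    rw [← inner_sub_left, ← real_inner_smul_left, ← h4, real_inner_self_eq_norm_sq]
  have h6 : ‖z - y‖ ^ 2 ≤ s * (‖z - y‖ ^ 2 / t) := by
    refine h5.le.trans ?_
    gcongr
    linarith
  have h7 : ‖z - y‖ ^ 2 * (t - s) ≤ 0 := by
    have : s * (‖z - y‖ ^ 2 / t) * t = s * ‖z - y‖ ^ 2 := by field_simp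
    have := mul_le_mul_of_nonneg_right h6 ht.le
    linarith
  have h8 : ‖z - y‖ ^ 2 ≤ 0 := nonpos_of_mul_nonpos_left h7 (by linarith)
  have h9 : ‖z - y‖ = 0 := by simpa using le_antisymm h8 (by positivity)
  exact (sub_eq_zero.1 (norm_eq_zero.1 h9)).symm

/-- For `s < t` the Hopf-Lax infimum at `y + s • p y` is attained at `y`. -/
theorem hopfLax_integrand_le
    (hlow : ∀ y k, f y + inner ℝ (p y) k - ‖k‖ ^ 2 / (2 * t) ≤ f (y + k))
    {s : ℝ} (hs : 0 < s) (hle : s < t) (y z : EuclideanSpace ℝ (Fin d)) :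
    s / 2 * ‖p y‖ ^ 2 + f y ≤ ‖y + s • p y - z‖ ^ 2 / (2 * s) + f z := by
  obtain ⟨k, rfl⟩ : ∃ k, z = y + k := ⟨z - y, by abel⟩
  have h1 := hlow y k
  rw [show y + s • p y - (y + k) = s • p y - k by abel, norm_sub_sq_real, norm_smul,
    Real.norm_of_nonneg hs.le, real_inner_smul_left]
  have h2 : ((s * ‖p y‖) ^ 2 - 2 * (s * inner ℝ (p y) k) + ‖k‖ ^ 2) / (2 * s) =
    s / 2 * ‖p y‖ ^ 2 - inner ℝ (p y) k + ‖k‖ ^ 2 / (2 * s) := by field_simp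
  have h3 : ‖k‖ ^ 2 / (2 * t) ≤ ‖k‖ ^ 2 / (2 * s) := by gcongr
  linarith

/-- A preimage of `x` is a minimiser in the Hopf-Lax formula at `x`. It exists because `1 / (2s) - 1
/ (2t) > 0` gives quadratic growth, and its first-order condition is `x = y + s • p y`. -/
theorem id_add_smul_surjective (hcont : Continuous f)
    (hlow : ∀ y k, f y + inner ℝ (p y) k - ‖k‖ ^ 2 / (2 * t) ≤ f (y + k))
    (hupp : ∀ y k, f (y + k) ≤ f y + inner ℝ (p y) k + lam / 2 * ‖k‖ ^ 2)
    {s : ℝ} (hs : 0 < s) (hst : s < t) : Function.Surjective fun y => y + s • p y := by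
  intro x
  have ht : 0 < t := hs.trans hst
  obtain ⟨y, hy⟩ := exists_forall_le_of_quadratic_growth
    (f := fun y => ‖x - y‖ ^ 2 / (2 * s) + f y) (by fun_prop)
    (a := f 0 + ‖x‖ ^ 2 / (2 * s)) (b := ‖p 0 - (1 / s) • x‖) (c := 1 / (2 * s) - 1 / (2 * t))
    (sub_pos.2 (by gcongr)) (fun z => by
      have h1 := hlow 0 z
      have h2 := neg_le_of_abs_le (abs_real_inner_le_norm (p 0 - (1 / s) • x) z)
      rw [inner_sub_left, real_inner_smul_left] at h2
      rw [zero_add] at h1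
      rw [norm_sub_sq_real]
      have h3 : (‖x‖ ^ 2 - 2 * inner ℝ x z + ‖z‖ ^ 2) / (2 * s) =
        ‖x‖ ^ 2 / (2 * s) - 1 / s * inner ℝ x z + 1 / (2 * s) * ‖z‖ ^ 2 := by field_simp
      have h4 : ‖z‖ ^ 2 / (2 * t) = 1 / (2 * t) * ‖z‖ ^ 2 := by field_simp
      rw [h3]
      linarith)
  refine ⟨y, ?_⟩
  have hr : p y - (1 / s) • (x - y) = 0 := by
    refine eq_zero_of_inner_add_sq_nonneg (C := lam / 2 + 1 / (2 * s)) fun k => ?_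
    have h1 := hy (y + k)
    have h2 := hupp y k
    rw [show x - (y + k) = x - y - k by abel, norm_sub_sq_real (x - y) k] at h1
    have h3 : (‖x - y‖ ^ 2 - 2 * inner ℝ (x - y) k + ‖k‖ ^ 2) / (2 * s) =
      ‖x - y‖ ^ 2 / (2 * s) - 1 / s * inner ℝ (x - y) k + 1 / (2 * s) * ‖k‖ ^ 2 := by field_simp
    rw [h3] at h1
    rw [inner_sub_left, real_inner_smul_left]
    linarith
  simp only
  rw [sub_eq_zero.1 hr, smul_smul, mul_one_div_cancel hs.ne', one_smul, add_sub_cancel]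

theorem mem_differential_hopfLax (hlam : 0 ≤ lam) (hcont : Continuous f)
    (hlow : ∀ y k, f y + inner ℝ (p y) k - ‖k‖ ^ 2 / (2 * t) ≤ f (y + k))
    (hupp : ∀ y k, f (y + k) ≤ f y + inner ℝ (p y) k + lam / 2 * ‖k‖ ^ 2)
    {s : ℝ} (hs : 0 < s) (hst : s < t) (y : EuclideanSpace ℝ (Fin d)) :
    p y ∈ differential (lam / (1 + lam * s)) (hopfLax f s) (y + s • p y) := by
  have ht : 0 < t := hs.trans hst
  -- By surjectivity every `z` lies on some line, where the integrand has an explicit minimum.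
  have hbdd : ∀ z, BddBelow (range fun v => ‖z - v‖ ^ 2 / (2 * s) + f v) := fun z => by
    obtain ⟨v, rfl⟩ := id_add_smul_surjective hcont hlow hupp hs hst z
    exact ⟨_, forall_mem_range.2 (hopfLax_integrand_le hlow hs hst v)⟩
  intro z
  have hval : s / 2 * ‖p y‖ ^ 2 + f y ≤ hopfLax f s (y + s • p y) :=
    le_ciInf (hopfLax_integrand_le hlow hs hst y)
  obtain ⟨h, rfl⟩ : ∃ h, z = y + s • p y + h := ⟨z - (y + s • p y), by abel⟩
  have h1 : 0 < 1 + lam * s := by positivity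
  -- This `c` minimises `(1 - c)² / (2s) + lam c² / 2`, with minimum `lam / (1 + lam s) / 2`; hence
  -- the competitor `y + c • h`.
  set c := 1 / (1 + lam * s) with hc
  have h2 : hopfLax f s (y + s • p y + h) ≤ _ := ciInf_le (hbdd _) (y + c • h)
  have h3 := hupp y (c • h)
  have h4 : 1 - c = lam * s * c := by rw [hc]; field_simp; ring
  rw [show y + s • p y + h - (y + c • h) = s • p y + (1 - c) • h by module, norm_add_sq_real,
    norm_smul, norm_smul, real_inner_smul_left, real_inner_smul_right,
    Real.norm_of_nonneg hs.le, h4, Real.norm_of_nonneg (by positivity)] at h2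
  have h5 : ((s * ‖p y‖) ^ 2 + 2 * (s * (lam * s * c * inner ℝ (p y) h)) +
      (lam * s * c * ‖h‖) ^ 2) / (2 * s) =
      s / 2 * ‖p y‖ ^ 2 + (lam * s * c) * inner ℝ (p y) h + lam ^ 2 * s * c ^ 2 * ‖h‖ ^ 2 / 2 := by
    field_simp
  rw [h5, ← h4] at h2
  rw [norm_smul, real_inner_smul_right, Real.norm_of_nonneg (by positivity)] at h3
  have h6 : lam ^ 2 * s * c ^ 2 * ‖h‖ ^ 2 / 2 + lam / 2 * (c * ‖h‖) ^ 2 =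
      lam / (1 + lam * s) / 2 * ‖h‖ ^ 2 := by
    rw [hc]; field_simp; ring
  rw [add_sub_cancel_left]
  linarith

/-- The straight lines `y + s • p y` form the Lagrangian flow up to time `t`. -/
theorem isLagrangianFlow_id_add_smul (hlam : 0 ≤ lam) (hcont : Continuous f)
    (hlow : ∀ y k, f y + inner ℝ (p y) k - ‖k‖ ^ 2 / (2 * t) ≤ f (y + k))
    (hupp : ∀ y k, f (y + k) ≤ f y + inner ℝ (p y) k + lam / 2 * ‖k‖ ^ 2) :
    IsLagrangianFlow lam f t fun s y => y + s • p y where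
  lipschitz y := by
    refine ⟨‖p y‖₊, LipschitzOnWith.of_dist_le_mul fun a _ b _ => ?_⟩
    rw [dist_add_left, dist_eq_norm, ← sub_smul, norm_smul, mul_comm, dist_eq_norm, coe_nnnorm]
  initial y := by simp
  inclusion y := by
    filter_upwards [ae_restrict_mem measurableSet_Ioo] with s hs
    refine ⟨p y, mem_differential_hopfLax hlam hcont hlow hupp hs.1 hs.2 y, ?_⟩
    simpa using ((hasDerivAt_id s).smul_const (p y)).const_add y

theorem id_add_smul_bijective (hcont : Continuous f)
    (hlow : ∀ y k, f y + inner ℝ (p y) k - ‖k‖ ^ 2 / (2 * t) ≤ f (y + k))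
    (hupp : ∀ y k, f (y + k) ≤ f y + inner ℝ (p y) k + lam / 2 * ‖k‖ ^ 2)
    {s : ℝ} (hs : 0 ≤ s) (hst : s < t) : Function.Bijective fun y => y + s • p y := by
  refine ⟨id_add_smul_injective (hs.trans_lt hst) hlow hs hst, ?_⟩
  rcases hs.eq_or_lt with rfl | hs
  · intro x
    exact ⟨x, by simp⟩
  · exact id_add_smul_surjective hcont hlow hupp hs hst

end Flow

/-! ### The streaming potential and the main theorem. -/

theorem LamConcave.streamPotential {d : ℕ} {φ : EuclideanSpace ℝ (Fin d) → ℝ} {lam t : ℝ}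
    (hφ : LamConcave lam φ) (ht : 0 ≤ t) :
    LamConcave (1 + t * lam) (streamPotential φ t) := by
  have h := ConcaveOn.smul ht hφ
  refine h.congr fun y _ => ?_
  simp only [_root_.streamPotential, smul_eq_mul]
  ring

theorem exists_mem_subgradient_streamPotential {d : ℕ} {φ : EuclideanSpace ℝ (Fin d) → ℝ}
    {K : NNReal} (hφ : LipschitzWith K φ) {t : ℝ} (ht : 0 ≤ t) (x : EuclideanSpace ℝ (Fin d)) :
    ∃ y, x ∈ subgradient (streamPotential φ t) y := by
  have hc := hφ.continuous
  obtain ⟨y, hy⟩ := exists_forall_le_of_quadratic_growth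
    (f := fun y => streamPotential φ t y - inner ℝ x y)
    (by unfold streamPotential; fun_prop)
    (a := t * φ 0) (b := t * K + ‖x‖) (c := 1 / 2) (by norm_num) (fun z => by
      have h1 := hφ.dist_le_mul z 0
      rw [Real.dist_eq, dist_zero_right] at h1
      have h2 := mul_le_mul_of_nonneg_left (neg_le_of_abs_le h1) ht
      have h3 := real_inner_le_norm x z
      unfold streamPotential
      linarith)
  refine ⟨y, fun z => ?_⟩
  have := hy z
  rw [inner_sub_right]
  linarith

theorem theorem5 {d : ℕ} (φ : EuclideanSpace ℝ (Fin d) → ℝ) (K : NNReal) (lam : ℝ)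
    (hlam : 0 ≤ lam) (hLip : LipschitzWith K φ) (hconc : LamConcave lam φ)
    (t : ℝ) (ht : 0 < t) :
    -- the gradients in the statement exist
    Differentiable ℝ (convexifiedPotential φ t) ∧
    Differentiable ℝ (modifiedPotential φ t) ∧
    -- the modified flow exists, and any solution of the differential inclusion is as described
    (∃ X, IsLagrangianFlow lam (modifiedPotential φ t) t X) ∧
    ∀ X, IsLagrangianFlow lam (modifiedPotential φ t) t X →
      (∀ s ∈ Set.Ico 0 t, Function.Bijective (X s) ∧
        ∀ y, X s y = y + s • gradient (modifiedPotential φ t) y) ∧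
      (∀ y, X t y = transportMap φ t y) ∧
      (∀ s ∈ Set.Icc 0 t, Measurable (X s)) ∧
      (∀ B : Set (EuclideanSpace ℝ (Fin d)), MeasurableSet B →
        MeasurableSet (subgradientImage (dualPotential φ t) B) ∧
        MeasureTheory.Measure.map (X t) MeasureTheory.volume B =
          mongeAmpere (dualPotential φ t) B) := by
  have hL : 0 < 1 + t * lam := by positivity
  have hm : 0 < 1 / (1 + t * lam) := by positivity
  have hw : HasStrongSupport (1 / (1 + t * lam)) (dualPotential φ t) :=
    (hconc.streamPotential ht.le).hasStrongSupport_legendre hL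
      (exists_mem_subgradient_streamPotential hLip ht.le)
  have hsub : ∀ y, y ∈ subgradient (dualPotential φ t) (transportMap φ t y) := fun y =>
    (hw.mem_subgradient_iff hm).2 rfl
  have hgrad : ∀ y, HasGradientAt (convexifiedPotential φ t) (transportMap φ t y) y := fun y =>
    hw.hasGradientAt_legendre hm (hsub y)
  have hbounds : ∀ y k, convexifiedPotential φ t y + inner ℝ (transportMap φ t y) k ≤
        convexifiedPotential φ t (y + k) ∧
      convexifiedPotential φ t (y + k) ≤ convexifiedPotential φ t y +
        inner ℝ (transportMap φ t y) k + (1 + t * lam) / 2 * ‖k‖ ^ 2 := fun y k => by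
    have h := hw.legendre_bounds hm (hsub y) k
    rw [one_div_one_div] at h
    exact h
  have hdiff : Differentiable ℝ (convexifiedPotential φ t) := fun y =>
    (hgrad y).differentiableAt
  have hmodeq : ∀ y, modifiedPotential φ t y * t = convexifiedPotential φ t y - 1 / 2 * ‖y‖ ^ 2 :=
    fun y => div_mul_cancel₀ _ ht.ne'
  -- The velocity carrying `y` to `T_t(y)` in time `t`; it turns out to be `∇φ̆`.
  set p : EuclideanSpace ℝ (Fin d) → EuclideanSpace ℝ (Fin d) :=
    fun y => (1 / t) • (transportMap φ t y - y) with hp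
  have hpin : ∀ y k, inner ℝ (p y) k * t = inner ℝ (transportMap φ t y) k - inner ℝ y k :=
    fun y k => by
      rw [hp, real_inner_smul_left, inner_sub_left]
      field_simp
  have hlow : ∀ y k, modifiedPotential φ t y + inner ℝ (p y) k - ‖k‖ ^ 2 / (2 * t) ≤
      modifiedPotential φ t (y + k) := fun y k => by
    refine le_of_mul_le_mul_right ?_ ht
    have h1 : ‖k‖ ^ 2 / (2 * t) * t = ‖k‖ ^ 2 / 2 := by field_simp
    rw [sub_mul, add_mul, hmodeq, hmodeq, hpin, h1, norm_add_sq_real]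
    linarith [(hbounds y k).1]
  have hupp : ∀ y k, modifiedPotential φ t (y + k) ≤
      modifiedPotential φ t y + inner ℝ (p y) k + lam / 2 * ‖k‖ ^ 2 := fun y k => by
    refine le_of_mul_le_mul_right ?_ ht
    rw [add_mul, add_mul, hmodeq, hmodeq, hpin, norm_add_sq_real]
    linarith [(hbounds y k).2]
  have hmgrad : ∀ y, HasGradientAt (modifiedPotential φ t) (p y) y := fun y =>
    hasGradientAt_of_quadratic_bounds (C := 1 / (2 * t) + lam / 2)
      (fun k => by
        have h1 : 0 ≤ lam / 2 * ‖k‖ ^ 2 := by positivity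
        have h2 : ‖k‖ ^ 2 / (2 * t) = 1 / (2 * t) * ‖k‖ ^ 2 := by field_simp
        linarith [hlow y k])
      (fun k => by
        have h1 : 0 ≤ 1 / (2 * t) * ‖k‖ ^ 2 := by positivity
        linarith [hupp y k])
  have hmdiff : Differentiable ℝ (modifiedPotential φ t) := fun y =>
    (hmgrad y).differentiableAt
  have hflow := isLagrangianFlow_id_add_smul hlam hmdiff.continuous hlow hupp
  have hTmeas : Measurable (transportMap φ t) :=
    (InnerProductSpace.toDual ℝ (EuclideanSpace ℝ (Fin d))).symm.continuous.measurable.comp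
      (measurable_fderiv ℝ (convexifiedPotential φ t))
  refine ⟨hdiff, hmdiff, ⟨_, hflow⟩, fun X hX => ?_⟩
  -- Uniqueness includes the endpoint `s = t`, since the inclusion is needed only a.e. on the open
  -- interval.
  have hXeq : ∀ s ∈ Icc 0 t, X s = fun y => y + s • p y := fun s hs =>
    funext fun y => hX.eqOn hlam hflow hs y
  have hXt : X t = transportMap φ t := by
    rw [hXeq t ⟨ht.le, le_rfl⟩]
    funext y
    simp only [hp]
    rw [smul_smul, mul_one_div_cancel ht.ne', one_smul, add_sub_cancel]
  refine ⟨fun s hs => ?_, fun y => by rw [hXt], fun s hs => ?_, fun B hB => ?_⟩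
  · rw [hXeq s ⟨hs.1, hs.2.le⟩]
    refine ⟨id_add_smul_bijective hmdiff.continuous hlow hupp hs.1 hs.2, fun y => ?_⟩
    rw [(hmgrad y).gradient]
  · rw [hXeq s hs]
    exact measurable_id.add (((hTmeas.sub measurable_id).const_smul (1 / t)).const_smul s)
  · have himage : subgradientImage (dualPotential φ t) B = transportMap φ t ⁻¹' B :=
      hw.subgradientImage_eq hm B
    rw [mongeAmpere, himage, hXt, Measure.map_apply hTmeas hB]
    exact ⟨hTmeas hB, rfl⟩
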